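/- Let $p$ be a prime, let $D$ be a finite $p$-group, let $E$ be a finite field of characteristic $p$, and let $A$ be a Dade $D$-algebra over $E$; that is, $A$ is an $E$-algebra on which $D$ acts by $E$-algebra automorphisms, $A$ is a full matrix algebra over $E$ (isomorphic as an $E$-algebra to $M_n(E)$ for some $n\ge 1$), and $A$ has a $D$-stable $E$-basis containing at least one element fixed by $D$. For $Q\le D$ let $A^Q$ be the algebra of $Q$-fixed elements of $A$, and let $A^D_Q\subseteq A^D$ be the image of the relative trace map $\mathrm{Tr}_Q^D\colon A^Q\to A^D$, $a\mapsto\sum_{g}g\cdot a$, with $g$ running over a set of representatives of the left cosets $gQ$ of $Q$ in $D$ (the action of $D$ on $A$ being written on the left). Then the Brauer quotient $$\bar A(D) := A^D\Big/\sum_{Q<D}A^D_Q$$ (the sum being over the proper subgroups $Q$ of $D$) is a full matrix algebra over $E$, i.e. $\bar A(D)\cong M_l(E)$ as $E$-algebras for some $l\ge 1$. -/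

import Mathlib

namespace DadeAlg

/-- `A` is a full matrix algebra over `E`: it is isomorphic, as an `E`-algebra, to the algebra of
`n × n` matrices over `E` for some `n ≥ 1`. -/
def IsFullMatrixAlgebra (E A : Type*) [Field E] [Ring A] [Algebra E A] : Prop :=
  ∃ n : ℕ, n ≠ 0 ∧ Nonempty (A ≃ₐ[E] Matrix (Fin n) (Fin n) E)

section GAlgebra

/- A `D`-algebra over `E` is an `E`-algebra `A` with an action of `D` by `E`-algebra automorphisms,
written on the left (a right action `x ^ d` corresponds to `d⁻¹ • x`). -/
variable (E D A : Type*) [Field E] [Group D] [Ring A] [Algebra E A]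
  [MulSemiringAction D A] [SMulCommClass D E A]

/-- `A` is a Dade `D`-algebra over `E`. -/
structure IsDadeAlgebra : Prop where
  isFullMatrixAlgebra : IsFullMatrixAlgebra E A
  /-- There is a `D`-stable `E`-basis `X` of `A` with an element that is fixed by `D`. -/
  exists_stable_basis : ∃ X : Set A, LinearIndepOn E id X ∧ Submodule.span E X = ⊤ ∧
    (∀ d : D, ∀ x ∈ X, d • x ∈ X) ∧ ∃ x ∈ X, ∀ d : D, d • x = x

variable {E D A}

/-- For `a ∈ A ^ Q`, the element `g • a` depends only on the coset `g Q`. -/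
def cosetSMul (Q : Subgroup D) (a : FixedPoints.subalgebra E A Q) (c : D ⧸ Q) : A :=
  Quotient.liftOn' c (fun g => g • (a : A)) fun g h hgh => by
    have := a.2 ⟨_, QuotientGroup.leftRel_apply.mp hgh⟩
    rw [Subgroup.mk_smul, mul_smul, inv_smul_eq_iff] at this
    exact this.symm

@[simp] theorem cosetSMul_mk (Q : Subgroup D) (a : FixedPoints.subalgebra E A Q) (g : D) :
    cosetSMul Q a (g : D ⧸ Q) = g • (a : A) := rfl

theorem smul_cosetSMul (Q : Subgroup D) (a : FixedPoints.subalgebra E A Q) (d : D) (c : D ⧸ Q) :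
    d • cosetSMul Q a c = cosetSMul Q a (d • c) := by
  induction c using QuotientGroup.induction_on with
  | H g => exact (mul_smul d g (a : A)).symm

/-- `A ^ D` is contained in `A ^ Q`. -/
theorem fixedPoints_le (Q : Subgroup D) :
    FixedPoints.subalgebra E A D ≤ FixedPoints.subalgebra E A Q :=
  fun _ ha q => ha (q : D)

variable [Finite D]

/-- The relative trace map `Tr_Q^D : A ^ Q → A ^ D`, sending `a` to the sum of the elements `g • a`
with `g` running over representatives of the cosets `g Q` in `D`. -/
noncomputable def relTrace (Q : Subgroup D) (a : FixedPoints.subalgebra E A Q) :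
    FixedPoints.subalgebra E A D :=
  letI := Fintype.ofFinite (D ⧸ Q)
  ⟨∑ c : D ⧸ Q, cosetSMul Q a c, fun d => by
    rw [Finset.smul_sum]
    simp only [smul_cosetSMul]
    exact Fintype.sum_equiv (MulAction.toPerm d) _ _ fun _ => rfl⟩

theorem relTrace_zero (Q : Subgroup D) : relTrace Q (0 : FixedPoints.subalgebra E A Q) = 0 := by
  apply Subtype.ext
  refine Finset.sum_eq_zero fun c _ => ?_
  induction c using QuotientGroup.induction_on with
  | H g => exact smul_zero g

theorem relTrace_add (Q : Subgroup D) (a b : FixedPoints.subalgebra E A Q) :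
    relTrace Q (a + b) = relTrace Q a + relTrace Q b := by
  apply Subtype.ext
  refine Eq.trans (Finset.sum_congr rfl fun c _ => ?_) Finset.sum_add_distrib
  induction c using QuotientGroup.induction_on with
  | H g => exact smul_add g _ _

theorem relTrace_mul_left (Q : Subgroup D) (x : FixedPoints.subalgebra E A D)
    (a : FixedPoints.subalgebra E A Q) :
    relTrace Q (Subalgebra.inclusion (fixedPoints_le Q) x * a) = x * relTrace Q a := by
  apply Subtype.ext
  refine Eq.trans (Finset.sum_congr rfl fun c _ => ?_) (Finset.mul_sum _ _ _).symm
  induction c using QuotientGroup.induction_on with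
  | H g => exact (smul_mul' g _ _).trans (congrArg (· * _) (x.2 g))

theorem relTrace_mul_right (Q : Subgroup D) (x : FixedPoints.subalgebra E A D)
    (a : FixedPoints.subalgebra E A Q) :
    relTrace Q (a * Subalgebra.inclusion (fixedPoints_le Q) x) = relTrace Q a * x := by
  apply Subtype.ext
  refine Eq.trans (Finset.sum_congr rfl fun c _ => ?_) (Finset.sum_mul _ _ _).symm
  induction c using QuotientGroup.induction_on with
  | H g => exact (smul_mul' g _ _).trans (congrArg (_ * ·) (x.2 g))

variable (E D A)

/-- The image `A ^ D_Q` of the relative trace map `Tr_Q^D`, an ideal of `A ^ D`. -/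
noncomputable def traceIdeal (Q : Subgroup D) : Ideal (FixedPoints.subalgebra E A D) where
  carrier := Set.range (relTrace Q)
  zero_mem' := ⟨0, relTrace_zero Q⟩
  add_mem' := by
    rintro _ _ ⟨a, rfl⟩ ⟨b, rfl⟩
    exact ⟨a + b, relTrace_add Q a b⟩
  smul_mem' := by
    rintro x _ ⟨a, rfl⟩
    exact ⟨_, relTrace_mul_left Q x a⟩

/-- The sum of the ideals `A ^ D_Q` over the proper subgroups `Q` of `D`. -/
noncomputable def brauerIdeal : Ideal (FixedPoints.subalgebra E A D) :=
  ⨆ (Q : Subgroup D) (_ : Q < ⊤), traceIdeal E D A Q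

instance brauerIdeal_isTwoSided : (brauerIdeal E D A).IsTwoSided where
  mul_mem_of_left {x} y hx := by
    let f : FixedPoints.subalgebra E A D →ₗ[FixedPoints.subalgebra E A D]
        FixedPoints.subalgebra E A D :=
      LinearMap.toSpanSingleton _ _ y
    suffices h : brauerIdeal E D A ≤ Submodule.comap f (brauerIdeal E D A) from h hx
    refine iSup₂_le fun Q hQ => ?_
    rintro _ ⟨a, rfl⟩
    exact (le_iSup₂ (f := fun (Q : Subgroup D) (_ : Q < ⊤) => traceIdeal E D A Q) Q hQ)
      ⟨_, relTrace_mul_right Q y a⟩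

/-- The Brauer quotient of `A`: the `E`-algebra `A ^ D` modulo the sum of the ideals `A ^ D_Q` over
the proper subgroups `Q` of `D`. -/
abbrev BrauerQuotient : Type _ := FixedPoints.subalgebra E A D ⧸ brauerIdeal E D A

end GAlgebra

end DadeAlg

namespace DadeAlg

open MulAction TensorProduct

/-! ### Recognising full matrix algebras over a finite field -/

section Azumaya

/-! Write `B` for the Brauer quotient. A full matrix algebra is Azumaya, so the maps `a ↦ x * a *
y`, with `x`, `y` in the stable basis, form a basis of `End E A`, permuted by `D`. An endomorphism
of `B` lifts to a `D`-equivariant endomorphism of `A`, whose coefficients in this basis are constant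
on orbits. Evaluated at a fixed `a`, the nontrivial orbits contribute relative traces, which vanish
in `B`; only pairs of fixed `x`, `y` survive (`mulLeftRight_brauerQuotient_surjective`). Hence every
endomorphism of `B` is a sum of left and right multiplications, and if `B ≠ 0` it is central simple,
so a matrix algebra by the two theorems of Wedderburn. The fixed basis element gives `B ≠ 0`; this
is where `D` being a `p`-group and the characteristic being `p` enter
(`repr_eq_zero_of_mem_brauerIdeal`). -/

/-- An algebra over a finite field all of whose endomorphisms are sums of left and right
multiplications is a full matrix algebra. -/
theorem isFullMatrixAlgebra_of_mulLeftRight_surjective (E B : Type*) [Field E] [Finite E] [Ring B]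
    [Algebra E B] [Module.Finite E B] [Nontrivial B]
    (h : Function.Surjective (AlgHom.mulLeftRight E B)) : IsFullMatrixAlgebra E B := by
  have hbij : Function.Bijective (AlgHom.mulLeftRight E B) := by
    refine ⟨?_, h⟩
    have hdim : Module.finrank E (B ⊗[E] Bᵐᵒᵖ) = Module.finrank E (Module.End E B) := by
      rw [Module.finrank_tensorProduct, Module.finrank_linearMap,
        (MulOpposite.opLinearEquiv E : B ≃ₗ[E] Bᵐᵒᵖ).finrank_eq]
    exact (LinearMap.injective_iff_surjective_of_finrank_eq_finrank
      (f := (AlgHom.mulLeftRight E B).toLinearMap) hdim).2 h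
  have : IsAzumaya E B := { bij := hbij }
  have hsimple : IsSimpleRing B := by
    refine .of_eq_bot_or_eq_top fun I => ?_
    refine or_iff_not_imp_left.2 fun hI => ?_
    obtain ⟨x, hx, hx0⟩ : ∃ x ∈ I, x ≠ 0 := by
      by_contra! hzero
      exact hI (eq_bot_iff.2 fun x hx => (TwoSidedIdeal.mem_bot _).2 (hzero x hx))
    -- Choose a functional `f` with `f x = 1`. The endomorphism `y ↦ f y • 1` is a sum of maps `y ↦
    -- a * y * b`, which preserve `I`, so it forces `1 ∈ I`.
    obtain ⟨f, hf⟩ := (LinearMap.toSpanSingleton E B x).exists_leftInverse_of_injective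
      (LinearMap.ker_toSpanSingleton E hx0)
    obtain ⟨t, ht⟩ := h (LinearMap.toSpanSingleton E B 1 ∘ₗ f)
    have hfx : f x = 1 := by simpa using LinearMap.congr_fun hf 1
    have hmem (t : B ⊗[E] Bᵐᵒᵖ) : AlgHom.mulLeftRight E B t x ∈ I := by
      induction t with
      | zero => simp [I.zero_mem]
      | tmul a b =>
        rw [AlgHom.mulLeftRight_apply]
        exact I.mul_mem_right _ _ (I.mul_mem_left _ _ hx)
      | add s t hs ht =>
        rw [map_add]
        exact I.add_mem hs ht
    have := hmem t
    rw [ht] at this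
    rw [← TwoSidedIdeal.one_mem_iff]
    simpa [hfx] using this
  have : Finite B := Module.finite_of_finite E
  have : IsArtinianRing B := inferInstance
  obtain ⟨n, hn, K, _, _, _, ⟨e⟩⟩ :=
    IsSimpleRing.exists_algEquiv_matrix_divisionRing_finite E B
  have : Finite K := Module.finite_of_finite E
  let _ : Field K := littleWedderburn K
  have hcentral : Algebra.IsCentral E (Matrix (Fin n) (Fin n) K) := .of_algEquiv E _ _ e
  -- As `K` is commutative, its scalar matrices are central, and the centre is `E`.
  have hsurj : Function.Surjective (algebraMap E K) := fun z => by
    have hz : Matrix.scalar (Fin n) z ∈ Subalgebra.center E (Matrix (Fin n) (Fin n) K) := by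
      rw [Subalgebra.mem_center_iff]
      exact fun M => ((Matrix.scalar_commute z (fun w => mul_comm _ _) M).eq).symm
    obtain ⟨c, hc⟩ := Algebra.IsCentral.mem_center_iff E |>.1 hz
    refine ⟨c, ?_⟩
    have := congrFun (congrFun hc 0) 0
    simpa [Matrix.algebraMap_matrix_apply] using this.symm
  let e' : E ≃ₐ[E] K := AlgEquiv.ofBijective (Algebra.ofId E K)
    ⟨(algebraMap E K).injective, hsurj⟩
  exact ⟨n, hn.out, ⟨e.trans e'.symm.mapMatrix⟩⟩

end Azumaya

/-! ### Orbit sums and relative traces -/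

section Orbits

variable {E D A : Type*} [Field E] [Group D] [Finite D] [Ring A] [Algebra E A]
  [MulSemiringAction D A] [SMulCommClass D E A]
variable {ι : Type*} [MulAction D ι]

theorem sum_orbit_eq_relTrace (v : ι → A) (hv : ∀ (d : D) i, v (d • i) = d • v i) (i : ι)
    (s : Finset ι) (hs : ∀ j, j ∈ s ↔ j ∈ orbit D i) :
    ∑ j ∈ s, v j = (relTrace (E := E) (stabilizer D i)
      ⟨v i, fun g => (hv g i).symm.trans (congrArg v g.2)⟩ : A) := by
  let _ := Fintype.ofFinite (D ⧸ stabilizer D i)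
  change _ = ∑ c : D ⧸ stabilizer D i, cosetSMul _ _ c
  refine (Finset.sum_bij (fun c _ => ((orbitEquivQuotientStabilizer D i).symm c : ι))
    ?_ ?_ ?_ ?_).symm
  · exact fun c _ => (hs _).2 (Subtype.coe_prop _)
  · exact fun c _ c' _ h => (orbitEquivQuotientStabilizer D i).symm.injective (Subtype.ext h)
  · exact fun j hj => ⟨orbitEquivQuotientStabilizer D i ⟨j, (hs j).1 hj⟩, Finset.mem_univ _,
      by simp⟩
  · intro c _
    induction c using QuotientGroup.induction_on with
    | H g => rw [orbitEquivQuotientStabilizer_symm_apply, cosetSMul_mk, hv]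

theorem traceIdeal_le_brauerIdeal {Q : Subgroup D} (hQ : Q < ⊤) :
    traceIdeal E D A Q ≤ brauerIdeal E D A :=
  le_iSup₂ (f := fun (Q : Subgroup D) (_ : Q < ⊤) => traceIdeal E D A Q) Q hQ

/-- The Brauer ideal as a subspace of `A`. -/
noncomputable def brauerSubmodule (E D A : Type*) [Field E] [Group D] [Finite D] [Ring A]
    [Algebra E A] [MulSemiringAction D A] [SMulCommClass D E A] : Submodule E A :=
  ((brauerIdeal E D A).restrictScalars E).map (FixedPoints.subalgebra E A D).val.toLinearMap

theorem coe_mem_brauerSubmodule (a : FixedPoints.subalgebra E A D) :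
    (a : A) ∈ brauerSubmodule E D A ↔ a ∈ brauerIdeal E D A := by
  refine ⟨?_, fun h => ⟨a, h, rfl⟩⟩
  rintro ⟨b, hb, hab⟩
  rwa [← Subtype.ext hab]

/-- The sum splits into orbits, on each of which `c` is constant. A nonfixed index has a proper
stabilizer, so its orbit sum is a relative trace from a proper subgroup. -/
theorem sum_nonfixed_mem_brauerSubmodule [Fintype ι] [DecidablePred (· ∈ fixedPoints D ι)]
    (v : ι → A) (hv : ∀ (d : D) i, v (d • i) = d • v i)
    (c : ι → E) (hc : ∀ (d : D) i, c (d • i) = c i) :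
    ∑ i with i ∉ fixedPoints D ι, c i • v i ∈ brauerSubmodule E D A := by
  classical
  let _ := Fintype.ofFinite (orbitRel.Quotient D ι)
  rw [← Finset.sum_fiberwise _ (fun i => (Quotient.mk'' i : orbitRel.Quotient D ι))]
  refine Submodule.sum_mem _ fun ω _ => ?_
  induction ω using Quotient.inductionOn' with
  | h i =>
    by_cases hi : i ∈ fixedPoints D ι
    · rw [Finset.sum_eq_zero]
      · exact zero_mem _
      · intro j hj
        simp only [Finset.mem_filter, Finset.mem_univ, true_and, Quotient.eq'',
          orbitRel_apply] at hj
        obtain ⟨hj, g, rfl⟩ := hj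
        refine (hj ?_).elim
        rwa [show (fun m : D => m • i) g = i from hi g]
    · have horb : ∀ j, j ∈ Finset.filter (fun j => (Quotient.mk'' j : orbitRel.Quotient D ι) =
          Quotient.mk'' i) (Finset.univ.filter (· ∉ fixedPoints D ι)) ↔ j ∈ orbit D i := by
        intro j
        simp only [Finset.mem_filter, Finset.mem_univ, true_and, Quotient.eq'', orbitRel_apply]
        refine ⟨And.right, fun h => ⟨fun hj => hi ?_, h⟩⟩
        obtain ⟨g, rfl⟩ := h
        have : g • i = i := by simpa using (hj g⁻¹).symm
        simpa [this] using hj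
      have hcc : ∀ j ∈ Finset.filter (fun j => (Quotient.mk'' j : orbitRel.Quotient D ι) =
          Quotient.mk'' i) (Finset.univ.filter (· ∉ fixedPoints D ι)), c j • v j = c i • v j := by
        intro j hj
        obtain ⟨g, rfl⟩ := (horb j).1 hj
        exact congrArg (· • _) (hc g i)
      rw [Finset.sum_congr rfl hcc, ← Finset.smul_sum, sum_orbit_eq_relTrace (E := E) v hv i _ horb]
      refine Submodule.smul_mem _ _ ((coe_mem_brauerSubmodule _).2
        (traceIdeal_le_brauerIdeal (lt_top_iff_ne_top.2 fun htop => hi fun g => ?_) ⟨_, rfl⟩))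
      exact mem_stabilizer_iff.1 (htop ▸ Subgroup.mem_top g)

/-- In the Brauer quotient only the fixed indices of an equivariant sum contribute. -/
theorem mk_eq_sum_fixed [Fintype ι] [DecidablePred (· ∈ fixedPoints D ι)]
    (v : ι → A) (hv : ∀ (d : D) i, v (d • i) = d • v i)
    (c : ι → E) (hc : ∀ (d : D) i, c (d • i) = c i) (a : FixedPoints.subalgebra E A D)
    (ha : (a : A) = ∑ i, c i • v i) :
    (Ideal.Quotient.mk (brauerIdeal E D A) a) = ∑ i : fixedPoints D ι,
      c i • Ideal.Quotient.mk (brauerIdeal E D A)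
        ⟨v i, fun d => (hv d i).symm.trans (congrArg v (i.2 d))⟩ := by
  have hmk (r : E) (x : FixedPoints.subalgebra E A D) :
      r • Ideal.Quotient.mk (brauerIdeal E D A) x = Ideal.Quotient.mk (brauerIdeal E D A) (r • x) :=
    rfl
  simp only [hmk]
  rw [← map_sum, Ideal.Quotient.eq, ← coe_mem_brauerSubmodule]
  convert sum_nonfixed_mem_brauerSubmodule v hv c hc using 1
  rw [AddSubgroupClass.coe_sub, AddSubmonoidClass.coe_finsetSum, ha, sub_eq_iff_eq_add']
  rw [← Finset.sum_filter_add_sum_filter_not _ (· ∈ fixedPoints D ι)]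
  congr 1
  exact (Finset.sum_subtype _ (by simp) _)

end Orbits

/-! ### Coordinates in a permutation basis, and lifting endomorphisms -/

section PermutationBasis

variable {E D A : Type*} [Field E] [Group D] [Ring A] [Algebra E A]
  [MulSemiringAction D A] [SMulCommClass D E A]
variable {ι : Type*} [MulAction D ι] (b : Module.Basis ι E A) (hb : ∀ (d : D) i, b (d • i) = d • b i)

include hb in
theorem repr_smul (d : D) (a : A) (i : ι) : b.repr (d • a) (d • i) = b.repr a i := by
  classical
  have : b.coord (d • i) ∘ₗ DistribSMul.toLinearMap E A d = b.coord i := by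
    refine b.ext fun j => ?_
    simp [← hb, Finsupp.single_apply]
  exact LinearMap.congr_fun this a

include hb in
theorem repr_smul_fixedPoints (a : FixedPoints.subalgebra E A D) (d : D) (i : ι) :
    b.repr (a : A) (d • i) = b.repr (a : A) i := by
  conv_lhs => rw [← a.2 d]
  exact repr_smul b hb d a i

include hb in
/-- The coordinate of a fixed basis element vanishes on relative traces from proper subgroups. -/
theorem repr_eq_zero_of_mem_brauerIdeal [Finite D] {p : ℕ} [Fact p.Prime] (hD : IsPGroup p D) [CharP E p]
    {i : ι} (hi : i ∈ fixedPoints D ι) {a : FixedPoints.subalgebra E A D}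
    (ha : a ∈ brauerIdeal E D A) : b.repr (a : A) i = 0 := by
  rw [brauerIdeal, iSup_subtype'] at ha
  induction ha using Submodule.iSup_induction' with
  | zero => simp
  | add x y _ _ hx hy => simp [hx, hy]
  | mem Q x hx =>
    obtain ⟨y, rfl⟩ := hx
    let _ := Fintype.ofFinite (D ⧸ Q.1)
    change b.repr (∑ c : D ⧸ Q.1, cosetSMul Q.1 y c) i = 0
    have hc (c : D ⧸ Q.1) : b.repr (cosetSMul Q.1 y c) i = b.repr (y : A) i := by
      induction c using QuotientGroup.induction_on with
      | H g =>
        rw [cosetSMul_mk]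
        conv_lhs => rw [← show g • i = i from hi g]
        exact repr_smul b hb g y i
    -- The trace has coordinate `Q.index` times that of `y`, and the index of a proper subgroup of a
    -- `p`-group is zero in `E`.
    have hp : p ∣ Q.1.index := by
      obtain ⟨n, hn⟩ := hD.index Q.1
      have hn0 : n ≠ 0 := by
        rintro rfl
        exact Q.2.ne (Subgroup.index_eq_one.1 (by simpa using hn))
      exact hn ▸ dvd_pow_self p hn0
    rw [map_sum, Finsupp.finsetSum_apply, Finset.sum_congr rfl fun c _ => hc c, Finset.sum_const,
      Finset.card_univ, ← Nat.card_eq_fintype_card]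
    change Q.1.index • _ = _
    rw [← Nat.cast_smul_eq_nsmul E, (CharP.cast_eq_zero_iff E p _).2 hp, zero_smul]

/-- The basis of `End E A` consisting of the maps `a ↦ x * a * y` for `x`, `y` in a given basis of
the Azumaya algebra `A`. -/
noncomputable def mulLeftRightBasis [IsAzumaya E A] : Module.Basis (ι × ι) E (Module.End E A) :=
  (b.tensorProduct (b.map (MulOpposite.opLinearEquiv E))).map
    (AlgEquiv.ofBijective (AlgHom.mulLeftRight E A) IsAzumaya.bij).toLinearEquiv

theorem mulLeftRightBasis_apply [IsAzumaya E A] (i : ι × ι) (a : A) :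
    mulLeftRightBasis b i a = b i.1 * a * b i.2 := by
  change AlgHom.mulLeftRight E A (b.tensorProduct (b.map (MulOpposite.opLinearEquiv E)) i) a = _
  rw [Module.Basis.tensorProduct_apply', AlgHom.mulLeftRight_apply]
  simp

-- Conjugation by `d` fixes the equivariant map `f` and permutes the basis `mulLeftRightBasis b`
-- through the diagonal action on `ι × ι`.
include hb in
theorem mulLeftRightBasis_repr_smul [IsAzumaya E A] (f : Module.End E A)
    (hf : ∀ (d : D) a, f (d • a) = d • f a) (d : D) (i : ι × ι) :
    (mulLeftRightBasis b).repr f (d • i) = (mulLeftRightBasis b).repr f i := by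
  classical
  let S (d : D) : A →ₗ[E] A := DistribSMul.toLinearMap E A d
  let conj : Module.End E A →ₗ[E] Module.End E A :=
    (LinearMap.llcomp E A A A (S d)) ∘ₗ LinearMap.lcomp E A (S d⁻¹)
  have hconj (g : Module.End E A) (a : A) : conj g a = d • g (d⁻¹ • a) := rfl
  have hfix : conj f = f := LinearMap.ext fun a => by rw [hconj, hf, smul_inv_smul]
  have hcoord : (mulLeftRightBasis b).coord (d • i) ∘ₗ conj = (mulLeftRightBasis b).coord i := by
    refine (mulLeftRightBasis b).ext fun j => ?_
    have : conj (mulLeftRightBasis b j) = mulLeftRightBasis b (d • j) := LinearMap.ext fun a => by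
      simp [hconj, mulLeftRightBasis_apply, hb, smul_mul']
    simp [this, Finsupp.single_apply]
  have := LinearMap.congr_fun hcoord f
  rwa [LinearMap.comp_apply, hfix] at this

include hb in
theorem mulLeftRight_brauerQuotient_surjective [Finite D] [Finite ι] [IsAzumaya E A] :
    Function.Surjective (AlgHom.mulLeftRight E (BrauerQuotient E D A)) := by
  classical
  intro φ
  have := Fintype.ofFinite ι
  let π : FixedPoints.subalgebra E A D →ₗ[E] BrauerQuotient E D A :=
    (Ideal.Quotient.mkₐ E (brauerIdeal E D A)).toLinearMap
  have : Module.Projective E (BrauerQuotient E D A) :=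
    @Module.Projective.of_free _ _ _ _ _ (Module.Free.of_divisionRing E _)
  obtain ⟨s, hs⟩ := π.exists_rightInverse_of_surjective
    (LinearMap.range_eq_top.2 (Ideal.Quotient.mkₐ_surjective E _))
  have hfix (i : fixedPoints D ι) (d : D) : d • b i = b i := by rw [← hb, i.2 d]
  -- Extends `π` from the fixed points to all of `A` by keeping only the fixed basis elements;
  -- unlike an arbitrary linear extension it is `D`-invariant.
  let ρ : A →ₗ[E] BrauerQuotient E D A :=
    ∑ i : fixedPoints D ι, (b.coord i).smulRight (π ⟨b i, hfix i⟩)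
  have hρ (a : FixedPoints.subalgebra E A D) : ρ a = π a := by
    have := mk_eq_sum_fixed b hb (b.repr (a : A)) (fun d i => repr_smul_fixedPoints b hb a d i) a
      (b.sum_repr _).symm
    refine Eq.trans ?_ this.symm
    simp [ρ, π]
  have hρD (d : D) (a : A) : ρ (d • a) = ρ a := by
    simp only [ρ, LinearMap.sum_apply, LinearMap.smulRight_apply, b.coord_apply]
    refine Finset.sum_congr rfl fun i _ => ?_
    refine congrArg (· • _) ?_
    have := repr_smul b hb d a i
    rwa [show d • (i : ι) = i from i.2 d] at this
  -- The lift of `φ`: equivariant because `ρ` is `D`-invariant and `s` takes values in the fixed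
  -- points.
  let f : Module.End E A := (FixedPoints.subalgebra E A D).val.toLinearMap ∘ₗ s ∘ₗ φ ∘ₗ ρ
  have hf (d : D) (a : A) : f (d • a) = d • f a := by
    change (s (φ (ρ (d • a))) : A) = d • (s (φ (ρ a)) : A)
    rw [hρD]
    exact ((s (φ (ρ a))).2 d).symm
  let c := (mulLeftRightBasis b).repr f
  have hc := mulLeftRightBasis_repr_smul b hb f hf
  have hfix₂ (i : fixedPoints D (ι × ι)) (d : D) :
      d • b i.1.1 = b i.1.1 ∧ d • b i.1.2 = b i.1.2 := by
    rw [← hb, ← hb]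
    exact ⟨congrArg (fun j : ι × ι => b j.1) (i.2 d), congrArg (fun j : ι × ι => b j.2) (i.2 d)⟩
  refine ⟨∑ i : fixedPoints D (ι × ι), c i • (π ⟨b i.1.1, fun d => (hfix₂ i d).1⟩ ⊗ₜ
    MulOpposite.op (π ⟨b i.1.2, fun d => (hfix₂ i d).2⟩)), LinearMap.ext fun x => ?_⟩
  obtain ⟨a, rfl⟩ := Ideal.Quotient.mkₐ_surjective E _ x
  have hfa : ((s (φ (π a)) : FixedPoints.subalgebra E A D) : A) =
      ∑ i, c i • (b i.1 * (a : A) * b i.2) := by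
    rw [← hρ]
    change f a = _
    have hsum := LinearMap.congr_fun ((mulLeftRightBasis b).sum_repr f) a
    rw [LinearMap.sum_apply] at hsum
    refine hsum.symm.trans (Finset.sum_congr rfl fun i _ => ?_)
    rw [LinearMap.smul_apply, mulLeftRightBasis_apply]
  -- Since `a` is fixed, `b i.1 * a * b i.2` is equivariant in the pair `i`; a fixed pair has both
  -- components fixed, so its factors pass to the quotient.
  have key := mk_eq_sum_fixed (D := D) (fun i : ι × ι => b i.1 * (a : A) * b i.2)
    (fun d i => by simp [hb, smul_mul', show d • (a : A) = a from a.2 d]) c hc _ hfa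
  have hsφ : π (s (φ (π a))) = φ (π a) := LinearMap.congr_fun hs _
  refine Eq.trans ?_ (key.symm.trans hsφ)
  rw [map_sum, LinearMap.sum_apply]
  refine Finset.sum_congr rfl fun i _ => ?_
  rw [map_smul, LinearMap.smul_apply, AlgHom.mulLeftRight_apply]
  rfl

end PermutationBasis
end DadeAlg

open DadeAlg in
theorem lemma4p1 (p : ℕ) [Fact p.Prime] (D : Type*) [Group D] [Finite D] (hD : IsPGroup p D)
    (E : Type*) [Field E] [Finite E] [CharP E p]
    (A : Type*) [Ring A] [Algebra E A] [MulSemiringAction D A] [SMulCommClass D E A]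
    (hA : DadeAlg.IsDadeAlgebra E D A) :
    DadeAlg.IsFullMatrixAlgebra E (DadeAlg.BrauerQuotient E D A) := by
  obtain ⟨⟨n, hn, ⟨e⟩⟩, X, hXli, hXspan, hXD, x, hx, hxD⟩ := hA
  have : NeZero n := ⟨hn⟩
  have hmat : IsAzumaya E (Matrix (Fin n) (Fin n) E) := .matrix E (Fin n)
  have : IsAzumaya E A := .of_AlgEquiv _ _ _ e.symm
  have : Finite A := Module.finite_of_finite E
  let S : SubMulAction D A := ⟨X, fun d {x} hx => hXD d x hx⟩
  let b : Module.Basis S E A := .mk (v := fun x : S => (x : A)) hXli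
    (by rw [← hXspan]; exact (congrArg _ Subtype.range_coe).ge)
  have hbS (i : S) : b i = i := Module.Basis.mk_apply _ _ i
  have hb (d : D) (i : S) : b (d • i) = d • b i := by rw [hbS, hbS]; rfl
  have : Module.Finite E (BrauerQuotient E D A) :=
    .of_surjective (Ideal.Quotient.mkₐ E (brauerIdeal E D A)).toLinearMap
      (Ideal.Quotient.mkₐ_surjective E _)
  -- The fixed basis element `x` has coordinate `1` at itself, whereas the Brauer ideal has
  -- coordinate `0` there.
  have hne : brauerIdeal E D A ≠ ⊤ := fun htop => by
    have h := repr_eq_zero_of_mem_brauerIdeal (D := D) b hb hD (i := (⟨x, hx⟩ : S))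
      (fun d => Subtype.ext (hxD d)) (a := ⟨x, hxD⟩) (htop ▸ Submodule.mem_top)
    have hbx : b ⟨x, hx⟩ = x := hbS _
    have h' : b.repr (b ⟨x, hx⟩) ⟨x, hx⟩ = 0 := by rw [hbx]; exact h
    simp at h'
  have : Nontrivial (BrauerQuotient E D A) := Ideal.Quotient.nontrivial_iff.2 hne
  exact isFullMatrixAlgebra_of_mulLeftRight_surjective E _
    (mulLeftRight_brauerQuotient_surjective b hb)
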